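/- Let $N\ge 1$. Define differential polynomials $L_k[u]$ by $L_0[u]=\tfrac12$ and $\frac{d}{dz}L_{k+1}[u]=\left(\frac{d^3}{dz^3}+4u\frac{d}{dz}+2u_z\right)L_k[u]$, with zero constants of integration, and let $$P_2^{(N)}[w,\alpha]=\left(\frac{d}{dz}+2w\right)L_N[w'-w^2]-zw-\alpha$$ be the left-hand side of the $N$-th equation of the second Painlevé hierarchy. Let $Q_n^{(N)}\in\mathbb{C}[z]$, $n\ge 0$, be the (generalised) Yablonskii–Vorob'ev polynomials: $Q_0^{(N)}=1$, every $Q_n^{(N)}$ is monic, and for every $n\ge 1$ the rational function $w=\frac{d}{dz}\ln\frac{Q_{n-1}^{(N)}}{Q_n^{(N)}}$ satisfies $P_2^{(N)}[w,n]=0$. For $m\ge 1$ let $s_{n,m}^{(N)}$ be the sum of the $m$-th powers of the roots of $Q_n^{(N)}$, counted with multiplicity. 1. Let $n\ge 2$ and $p=n(n+1)/2$. Then $\deg Q_n^{(N)}=p$, and the power sums $s_{n,m}^{(N)}$ with $m>p$ carry no new information about the roots of $Q_n^{(N)}$: writing $Q_n^{(N)}(z)=\sum_{k=0}^{p}A_k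 z^{p-k}$ with $A_0=1$, and $s_m=s_{n,m}^{(N)}$, Newton's identities $$kA_k+\sum_{j=1}^{k}s_jA_{k-j}=0\quad(1\le k\le p),\qquad s_m+\sum_{j=1}^{p}A_j s_{m-j}=0\quad(m>p)$$ hold, so that $s_1,\dots,s_p$ determine $Q_n^{(N)}$ and all the $s_m$; moreover for every $m>p$ there is a polynomial $F$ in $p$ variables with rational coefficients, depending only on $p$ and $m$, such that $s_m=F(s_1,\dots,s_p)$ holds for the power sums of the roots of every monic polynomial of degree $p$ over $\mathbb{C}$, in particular for those of $Q_n^{(N)}$. 2. For every $l\ge 1$, $s_{n,(2N+1)l}^{(N)}$ is a polynomial in $n$ of degree $2(Nl+1)$: there is $S\in\mathbb{C}[x]$ of degree exactly $2(Nl+1)$, depending only on $N$ and $l$, with $s_{n,(2N+1)l}^{(N)}=S(n)$ for all $n\ge 0$. -/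

import Mathlib

open Polynomial
open scoped BigOperators

noncomputable section

namespace PainleveTwo

/-- Differential polynomials in one unknown `u`: the variable `X k` stands for the `k`-th
derivative `d^k u / dz^k`. -/
abbrev DiffPoly : Type := MvPolynomial ℕ ℂ

/-- The total derivative `d/dz` on differential polynomials: `X k ↦ X (k + 1)`. -/
def totalDeriv : Derivation ℂ DiffPoly DiffPoly :=
  MvPolynomial.mkDerivation ℂ fun k => MvPolynomial.X (k + 1)

/-- The Lenard differential polynomials `L_0 = 1/2`, `L_1 = u`, `L_2 = u'' + 3u²`, …, given by the
integrated form of the Lenard recursion. The relation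
`d/dz L_{N+1} = (d³/dz³ + 4 u d/dz + 2 u') L_N` is proved in `totalDeriv_lenard_succ`, and the
vanishing of the integration constants in `constantCoeff_lenard_succ`. -/
def lenard : ℕ → DiffPoly
  | 0 => MvPolynomial.C (1 / 2)
  | n + 1 =>
      2 * ∑ i : Fin (n + 1),
          (lenard i * totalDeriv (totalDeriv (lenard (n - i)))
            - MvPolynomial.C (1 / 2) * (totalDeriv (lenard i) * totalDeriv (lenard (n - i)))
            + 2 * MvPolynomial.X 0 * (lenard i * lenard (n - i)))
        - ∑ i : Fin n, lenard (i + 1) * lenard (n - i)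
  termination_by n => n
  decreasing_by all_goals omega

/-- The derivative of a rational function, by the quotient rule. -/
def ratDeriv (f : RatFunc ℂ) : RatFunc ℂ :=
  (algebraMap ℂ[X] (RatFunc ℂ) (derivative f.num * f.denom - f.num * derivative f.denom))
    / algebraMap ℂ[X] (RatFunc ℂ) f.denom ^ 2

/-- The value `P[u]` of a differential polynomial `P` at a rational function `u`. -/
def DiffPoly.evalAt (P : DiffPoly) (u : RatFunc ℂ) : RatFunc ℂ :=
  MvPolynomial.aeval (fun k => ratDeriv^[k] u) P

/-- The left-hand side `(d/dz + 2w) L_N[w' - w²] - z w - α` of the `N`-th equation of the second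
Painlevé hierarchy, at a rational function `w`. -/
def painleveTwo (N : ℕ) (w : RatFunc ℂ) (α : ℂ) : RatFunc ℂ :=
  ratDeriv ((lenard N).evalAt (ratDeriv w - w ^ 2))
    + 2 * w * (lenard N).evalAt (ratDeriv w - w ^ 2)
    - RatFunc.X * w - RatFunc.C α

/-- The logarithmic derivative `d/dz ln (P / Q)` of a quotient of polynomials. -/
def logDerivQuot (P Q : ℂ[X]) : RatFunc ℂ :=
  ratDeriv (algebraMap ℂ[X] (RatFunc ℂ) P / algebraMap ℂ[X] (RatFunc ℂ) Q)
    / (algebraMap ℂ[X] (RatFunc ℂ) P / algebraMap ℂ[X] (RatFunc ℂ) Q)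

/-- `IsYablonskiiVorobev N n Q`: the polynomial `Q` is the `n`-th (generalised)
Yablonskii–Vorob'ev polynomial `Q_n^{(N)}` of the `N`-th equation of the second Painlevé hierarchy.
That is, `Q_0 = 1`, all `Q_n` are monic, and for `n ≥ 1` the rational function
`w = d/dz ln (Q_{n-1} / Q_n)` solves the `N`-th equation with `α = n`. -/
inductive IsYablonskiiVorobev (N : ℕ) : ℕ → ℂ[X] → Prop
  | zero : IsYablonskiiVorobev N 0 1
  | succ {n : ℕ} {P Q : ℂ[X]} (hP : IsYablonskiiVorobev N n P) (hQ : Q.Monic)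
      (hw : painleveTwo N (logDerivQuot P Q) ((n + 1 : ℕ) : ℂ) = 0) :
      IsYablonskiiVorobev N (n + 1) Q

/-- The sum of the `m`-th powers of the roots of `Q`, counted with multiplicity. -/
def rootPowerSum (Q : ℂ[X]) (m : ℕ) : ℂ :=
  (Q.roots.map fun a => a ^ m).sum

/-! ### The Lenard recursion -/

theorem constantCoeff_totalDeriv (P : DiffPoly) :
    MvPolynomial.constantCoeff (totalDeriv P) = 0 := by
  induction P using MvPolynomial.induction_on with
  | C a => simp [totalDeriv, MvPolynomial.derivation_C]
  | add p q hp hq => simp [hp, hq]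
  | mul_X p k hp => simp [totalDeriv, MvPolynomial.mkDerivation_X]

/-- The integration constants in the Lenard recursion are all zero. -/
theorem constantCoeff_lenard_succ (n : ℕ) :
    MvPolynomial.constantCoeff (lenard (n + 1)) = 0 := by
  induction n using Nat.strong_induction_on with
  | _ n ih =>
    rw [lenard]
    simp only [map_sub, map_mul, map_sum, map_add, constantCoeff_totalDeriv,
      MvPolynomial.constantCoeff_X, mul_zero, zero_mul, sub_zero, add_zero,
      Finset.sum_const_zero, zero_sub, neg_eq_zero]
    refine Finset.sum_eq_zero fun i _ => ?_
    rw [ih i i.2, zero_mul]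

/-- The defining quadratic relation, with all terms of degree two on the left. -/
theorem lenard_quadratic (n : ℕ) :
    ∑ ij ∈ Finset.HasAntidiagonal.antidiagonal (n + 1), lenard ij.1 * lenard ij.2
      = 2 * ∑ ij ∈ Finset.HasAntidiagonal.antidiagonal n,
          (lenard ij.1 * totalDeriv (totalDeriv (lenard ij.2))
            - MvPolynomial.C (1 / 2) * (totalDeriv (lenard ij.1) * totalDeriv (lenard ij.2))
            + 2 * MvPolynomial.X 0 * (lenard ij.1 * lenard ij.2)) := by
  have h := lenard.eq_2 n
  rw [Fin.sum_univ_eq_sum_range (fun i => lenard i * totalDeriv (totalDeriv (lenard (n - i)))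
            - MvPolynomial.C (1 / 2) * (totalDeriv (lenard i) * totalDeriv (lenard (n - i)))
            + 2 * MvPolynomial.X 0 * (lenard i * lenard (n - i))),
    Fin.sum_univ_eq_sum_range (fun i => lenard (i + 1) * lenard (n - i))] at h
  rw [Finset.Nat.sum_antidiagonal_eq_sum_range_succ_mk,
    Finset.Nat.sum_antidiagonal_eq_sum_range_succ_mk]
  simp only
  rw [Finset.sum_range_succ', Finset.sum_range_succ]
  simp only [Nat.succ_eq_add_one, Nat.sub_self, Nat.sub_zero, Nat.add_sub_add_right]
  have h0 : lenard 0 + lenard 0 = 1 := by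
    rw [lenard, ← MvPolynomial.C_add]
    norm_num
  linear_combination h + lenard (n + 1) * h0

/-- The Lenard recursion `d/dz L_{N+1} = (d³/dz³ + 4 u d/dz + 2 u') L_N`. -/
theorem totalDeriv_lenard_succ (n : ℕ) :
    totalDeriv (lenard (n + 1))
      = totalDeriv (totalDeriv (totalDeriv (lenard n)))
        + 4 * MvPolynomial.X 0 * totalDeriv (lenard n)
        + 2 * MvPolynomial.X 1 * lenard n := by
  set T : DiffPoly → DiffPoly := fun P => totalDeriv (totalDeriv (totalDeriv P))
        + 4 * MvPolynomial.X 0 * totalDeriv P + 2 * MvPolynomial.X 1 * P with hT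
  have hX : totalDeriv (MvPolynomial.X 0) = MvPolynomial.X 1 := by
    simp [totalDeriv, MvPolynomial.mkDerivation_X]
  have hC : ∀ a : ℂ, totalDeriv (MvPolynomial.C a) = 0 := fun a =>
    MvPolynomial.derivation_C totalDeriv a
  have hC2 : (MvPolynomial.C 2 : DiffPoly) = 2 := map_ofNat MvPolynomial.C 2
  have h2 : totalDeriv (2 : DiffPoly) = 0 := hC2 ▸ hC 2
  have hhalf : (MvPolynomial.C (1 / 2) : DiffPoly) * 2 = 1 := by
    rw [← hC2, ← MvPolynomial.C_mul]
    norm_num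
  have hD0 : totalDeriv (lenard 0) = 0 := by rw [lenard]; exact hC _
  have swap : ∀ (m : ℕ) (f : ℕ → ℕ → DiffPoly),
      ∑ ij ∈ Finset.HasAntidiagonal.antidiagonal m, f ij.1 ij.2
        = ∑ ij ∈ Finset.HasAntidiagonal.antidiagonal m, f ij.2 ij.1 := fun m f =>
    (Finset.Nat.sum_antidiagonal_swap (f := fun ij => f ij.1 ij.2)).symm
  -- the differentiated quadratic relation
  have key : ∀ n, ∑ ij ∈ Finset.HasAntidiagonal.antidiagonal n,
      lenard ij.1 * (totalDeriv (lenard (ij.2 + 1)) - T (lenard ij.2)) = 0 := by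
    intro n
    let h : ℕ → ℕ → DiffPoly := fun i j =>
      MvPolynomial.C (1 / 2) * (totalDeriv (lenard i) * totalDeriv (totalDeriv (lenard j)))
        + 2 * MvPolynomial.X 0 * (totalDeriv (lenard i) * lenard j)
    have q := congrArg totalDeriv (lenard_quadratic n)
    rw [Derivation.leibniz, h2, smul_zero, add_zero, map_sum, map_sum, smul_eq_mul] at q
    have ql : ∑ ij ∈ Finset.HasAntidiagonal.antidiagonal (n + 1),
          totalDeriv (lenard ij.1 * lenard ij.2)
        = 2 * ∑ ij ∈ Finset.HasAntidiagonal.antidiagonal n,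
            lenard ij.1 * totalDeriv (lenard (ij.2 + 1)) := by
      simp only [Derivation.leibniz, smul_eq_mul, Finset.sum_add_distrib]
      rw [swap (n + 1) fun i j => lenard j * totalDeriv (lenard i), ← two_mul,
        Finset.Nat.antidiagonal_succ']
      simp [hD0]
    have qr : ∑ ij ∈ Finset.HasAntidiagonal.antidiagonal n, totalDeriv
          (lenard ij.1 * totalDeriv (totalDeriv (lenard ij.2))
            - MvPolynomial.C (1 / 2) * (totalDeriv (lenard ij.1) * totalDeriv (lenard ij.2))
            + 2 * MvPolynomial.X 0 * (lenard ij.1 * lenard ij.2))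
        = ∑ ij ∈ Finset.HasAntidiagonal.antidiagonal n,
            (lenard ij.1 * T (lenard ij.2) + (h ij.1 ij.2 - h ij.2 ij.1)) := by
      refine Finset.sum_congr rfl fun ij _ => ?_
      simp only [map_sub, map_add, Derivation.leibniz, smul_eq_mul, hC, h2, hX, hT, h]
      linear_combination (-(totalDeriv (lenard ij.1) * totalDeriv (totalDeriv (lenard ij.2)))) * hhalf
    rw [ql, qr, Finset.sum_add_distrib, Finset.sum_sub_distrib, swap n h, sub_self, add_zero] at q
    simp only [mul_sub, Finset.sum_sub_distrib]
    exact sub_eq_zero.2 (mul_left_cancel₀ two_ne_zero q)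
  induction n using Nat.strong_induction_on with
  | _ n ih =>
    have hk := key n
    rw [Finset.sum_eq_single (0, n)] at hk
    · have h0 : lenard 0 ≠ 0 := by
        rw [lenard]
        simp
      exact sub_eq_zero.1 ((mul_eq_zero.1 hk).resolve_left h0)
    · rintro ⟨i, j⟩ hij hne
      rw [Finset.HasAntidiagonal.mem_antidiagonal] at hij
      have hj : j < n := by
        rcases Nat.eq_zero_or_pos i with rfl | hi
        · exact absurd (by simpa using hij) hne
        · simp only at hij
          omega
      rw [ih j hj]
      simp [hT]
    · simp

end PainleveTwo

end

/-! Expand `w = d/dz ln (Q_{n-1} / Q_n)` at infinity: the coefficient of `z^(-m-1)` is `s_{n-1,m} -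
s_{n,m}` (`expansion_logDerivQuot`). With `H(w) = (d/dz + 2w) L_N[w' - w²]` the equation reads `w =
z⁻¹ (H(w) - α)`, and the right side is a contraction in the `1/z`-adic sense. So `w` is determined
by `α`, and its coefficients `c_m(α)` are polynomials in `α` (`sub_approxSol_mem`, `map_approxSol`).
Summing `s_{n,m} - s_{n-1,m} = -c_m(n)` from `Q_0 = 1` makes `s_{n,m}` a polynomial in `n`, of
degree `deg c_m + 1` when `c_m ≠ 0`. The case `m = 0`, with `c_0 = -α`, gives `deg Q_n`.

For `m = (2N+1) l` the degree of `c_m` comes from trading large `α` for small dispersion. By weight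
homogeneity of `L_N`, the solution for `α` and `d/dz` is a rescaling of the one for parameter `1`
and `δ d/dz`, `δ = 1/α` (`approxSol_scaling`); hence `c_m(α) = α^(2Nl+1) b(1/α)` with `b` a
polynomial. At `δ = 0` the equation is algebraic, its solution is a Fuss–Catalan series, and `b(0) ≠
0`. So `deg c_m = 2Nl + 1`.

The first part is a fact about all monic polynomials: over `ℚ`, Newton's identities can be solved
for the coefficients, and then for the higher power sums. -/

noncomputable section

namespace PainleveTwo

/-! ### Differential polynomials in a differential algebra -/

section DifferentialAlgebra

variable {A B : Type*} [CommRing A] [Algebra ℂ A] [CommRing B] [Algebra ℂ B]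

/-- The value of a differential polynomial at an element `u` of a differential algebra. -/
def evalDiff (d : Derivation ℂ A A) (u : A) : DiffPoly →ₐ[ℂ] A :=
  MvPolynomial.aeval fun k => d^[k] u

/-- The differential operator `(d + 2w) L_N[dw - w²]`. -/
def hierarchyOp (N : ℕ) (d : Derivation ℂ A A) (w : A) : A :=
  d (evalDiff d (d w - w ^ 2) (lenard N)) + 2 * w * evalDiff d (d w - w ^ 2) (lenard N)

theorem evalDiff_X (d : Derivation ℂ A A) (u : A) (k : ℕ) :
    evalDiff d u (MvPolynomial.X k) = d^[k] u := by
  simp [evalDiff]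

theorem evalDiff_C (d : Derivation ℂ A A) (u : A) (a : ℂ) :
    evalDiff d u (MvPolynomial.C a) = algebraMap ℂ A a := by
  simp [evalDiff]

theorem map_evalDiff (g : A →ₐ[ℂ] B) (d : Derivation ℂ A A) (e : Derivation ℂ B B)
    (h : ∀ x, g (d x) = e (g x)) (u : A) (P : DiffPoly) :
    g (evalDiff d u P) = evalDiff e (g u) P := by
  have hk : ∀ k : ℕ, g (d^[k] u) = e^[k] (g u) := fun k =>
    (Function.Semiconj.iterate_right (f := g) (ga := d) (gb := e) h k) u
  simp only [evalDiff]
  rw [← AlgHom.comp_apply, MvPolynomial.comp_aeval]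
  simp only [hk]

/-- Serves every change of ring below: specialising parameters, rescaling the variable, and passing
from power series to Laurent series. -/
theorem map_hierarchyOp (N : ℕ) (g : A →ₐ[ℂ] B) (d : Derivation ℂ A A) (e : Derivation ℂ B B)
    (h : ∀ x, g (d x) = e (g x)) (w : A) :
    g (hierarchyOp N d w) = hierarchyOp N e (g w) := by
  simp only [hierarchyOp, map_add, map_mul, map_evalDiff g d e h, h, map_sub, map_pow, map_ofNat]

/-- Differential polynomials respect congruences modulo differential ideals. -/
theorem evalDiff_sub_mem (d : Derivation ℂ A A) (I : Ideal A) (hI : ∀ x ∈ I, d x ∈ I) {u v : A}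
    (h : u - v ∈ I) (P : DiffPoly) : evalDiff d u P - evalDiff d v P ∈ I := by
  induction P using MvPolynomial.induction_on with
  | C a => simp
  | add p q hp hq =>
    have := I.add_mem hp hq
    rwa [sub_add_sub_comm, ← map_add, ← map_add] at this
  | mul_X p k hp =>
    have hk : d^[k] u - d^[k] v ∈ I := by
      induction k with
      | zero => simpa
      | succ k ih =>
        rw [Function.iterate_succ_apply', Function.iterate_succ_apply', ← map_sub]
        exact hI _ ih
    rw [map_mul, map_mul, evalDiff_X, evalDiff_X]
    have := I.add_mem (I.mul_mem_right (d^[k] u) hp) (I.mul_mem_left (evalDiff d v p) hk)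
    convert this using 1
    ring

/-- With `I = (X^k)` this is what makes the fixed-point iteration contract: the factor `X` in front
then gains one order. -/
theorem hierarchyOp_sub_mem (N : ℕ) (d : Derivation ℂ A A) (I : Ideal A) (hI : ∀ x ∈ I, d x ∈ I)
    {v w : A} (h : v - w ∈ I) : hierarchyOp N d v - hierarchyOp N d w ∈ I := by
  have hu : (d v - v ^ 2) - (d w - w ^ 2) ∈ I := by
    have := I.sub_mem (hI _ h) (I.mul_mem_left (v + w) h)
    rw [map_sub] at this
    convert this using 1
    ring
  have hL := evalDiff_sub_mem d I hI hu (lenard N)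
  have h1 := hI _ hL
  rw [map_sub] at h1
  have := I.add_mem h1 (I.add_mem (I.mul_mem_left (2 * v) hL)
    (I.mul_mem_left (2 * evalDiff d (d w - w ^ 2) (lenard N)) h))
  convert this using 1
  simp only [hierarchyOp]
  ring

/-! ### Weight homogeneity of the Lenard polynomials -/

/-- The substitution `X k ↦ c ^ (k + 2) X k`, which measures the weight of a differential
polynomial. -/
def weightScale (c : ℂ) : DiffPoly →ₐ[ℂ] DiffPoly :=
  MvPolynomial.aeval fun k => MvPolynomial.C (c ^ (k + 2)) * MvPolynomial.X k

theorem weightScale_totalDeriv (c : ℂ) (P : DiffPoly) :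
    weightScale c (totalDeriv P) = MvPolynomial.C c * totalDeriv (weightScale c P) := by
  have hC : ∀ a : ℂ, totalDeriv (MvPolynomial.C a) = 0 := fun a =>
    MvPolynomial.derivation_C totalDeriv a
  have hX : ∀ k, totalDeriv (MvPolynomial.X k) = MvPolynomial.X (k + 1) := fun k => by
    simp [totalDeriv, MvPolynomial.mkDerivation_X]
  have wX : ∀ k, weightScale c (MvPolynomial.X k)
      = MvPolynomial.C (c ^ (k + 2)) * MvPolynomial.X k := fun k => by simp [weightScale]
  have wC : ∀ a, weightScale c (MvPolynomial.C a) = MvPolynomial.C a := fun a => by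
    simp [weightScale, MvPolynomial.algebraMap_eq]
  induction P using MvPolynomial.induction_on with
  | C a => simp [hC, wC]
  | add p q hp hq => simp only [map_add, hp, hq, mul_add]
  | mul_X p k hp =>
    simp only [Derivation.leibniz, smul_eq_mul, map_add, map_mul, hX, wX, hp, hC, mul_zero,
      add_zero]
    have : (MvPolynomial.C (c ^ (k + 1 + 2)) : DiffPoly)
        = MvPolynomial.C c * MvPolynomial.C (c ^ (k + 2)) := by
      rw [← MvPolynomial.C_mul]; ring_nf
    rw [this]
    ring

/-- `L_n` has weight `2n` when `X k` has weight `k + 2`. -/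
theorem weightScale_lenard (c : ℂ) (n : ℕ) :
    weightScale c (lenard n) = MvPolynomial.C (c ^ (2 * n)) * lenard n := by
  have wX : weightScale c (MvPolynomial.X 0)
      = MvPolynomial.C (c ^ 2) * MvPolynomial.X 0 := by simp [weightScale]
  have wC : ∀ a, weightScale c (MvPolynomial.C a) = MvPolynomial.C a := fun a => by
    simp [weightScale, MvPolynomial.algebraMap_eq]
  have hC : ∀ (a : ℂ) (P : DiffPoly), totalDeriv (MvPolynomial.C a * P)
      = MvPolynomial.C a * totalDeriv P := fun a P => by
    rw [Derivation.leibniz, show totalDeriv (MvPolynomial.C a) = 0 from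
      MvPolynomial.derivation_C totalDeriv a]
    simp
  induction n using Nat.strong_induction_on with
  | _ n ih =>
    cases n with
    | zero => simp [lenard, wC]
    | succ n =>
      rw [lenard]
      simp only [map_sub, map_mul, map_add, map_sum, map_ofNat, wC, wX, weightScale_totalDeriv,
        mul_sub]
      congr 1
      · rw [Finset.mul_sum, Finset.mul_sum, Finset.mul_sum]
        refine Finset.sum_congr rfl fun ⟨i, hi⟩ _ => ?_
        dsimp only
        rw [ih i hi, ih (n - i) (by omega)]
        simp only [hC]
        obtain ⟨j, hj⟩ : ∃ j, n = i + j := ⟨n - i, by omega⟩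
        have : n - i = j := by omega
        rw [this, hj]
        simp only [map_pow]
        ring
      · rw [Finset.mul_sum]
        refine Finset.sum_congr rfl fun ⟨i, hi⟩ _ => ?_
        dsimp only
        rw [ih (i + 1) (by omega), ih (n - i) (by omega)]
        obtain ⟨j, hj⟩ : ∃ j, n = i + j := ⟨n - i, by omega⟩
        have : n - i = j := by omega
        rw [this, hj]
        simp only [map_pow]
        ring

/-- As `c` is a constant, the `k`-th derivative picks up `c^(k+2)`, which is the substitution
`weightScale c`. -/
theorem evalDiff_smul (c : ℂ) (d : Derivation ℂ A A) (u : A) (n : ℕ) :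
    evalDiff (c • d) (c ^ 2 • u) (lenard n) = c ^ (2 * n) • evalDiff d u (lenard n) := by
  have hk : ∀ k : ℕ, (c • d)^[k] (c ^ 2 • u) = c ^ (k + 2) • d^[k] u := fun k => by
    induction k with
    | zero => simp
    | succ k ih =>
      rw [Function.iterate_succ_apply', Function.iterate_succ_apply', ih, Derivation.smul_apply,
        Derivation.map_smul, smul_smul]
      ring_nf
  have h : evalDiff (c • d) (c ^ 2 • u) = (evalDiff d u).comp (weightScale c) := by
    refine MvPolynomial.algHom_ext fun k => ?_
    rw [AlgHom.comp_apply, evalDiff_X, hk, weightScale, MvPolynomial.aeval_X, map_mul, evalDiff_C,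
      evalDiff_X, Algebra.smul_def]
  rw [h, AlgHom.comp_apply, weightScale_lenard, map_mul, evalDiff_C, Algebra.smul_def]

/-- Here `w` and `d` have weight 1, so `dw - w²` has weight 2, `L_N` of it `2N`, and the outer
operator adds 1. -/
theorem hierarchyOp_smul (N : ℕ) (c : ℂ) (d : Derivation ℂ A A) (w : A) :
    hierarchyOp N (c • d) (c • w) = c ^ (2 * N + 1) • hierarchyOp N d w := by
  have hu : (c • d) (c • w) - (c • w) ^ 2 = c ^ 2 • (d w - w ^ 2) := by
    rw [Derivation.smul_apply, Derivation.map_smul, smul_smul, smul_sub, _root_.smul_pow, pow_two c]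
  simp only [hierarchyOp]
  rw [hu, evalDiff_smul, Derivation.smul_apply, Derivation.map_smul]
  simp only [Algebra.smul_def, map_pow]
  ring

end DifferentialAlgebra

/-! ### The dispersionless limit -/

/-- The generating series is `F = (1 - 4X)^(-1/2)`: the recursion for central binomials gives `F' (1
- 4X) = 2F`, so `F² (1 - 4X)` has derivative zero and constant term 1. -/
theorem sum_centralBinom_mul_centralBinom (n : ℕ) :
    ∑ ij ∈ Finset.HasAntidiagonal.antidiagonal n,
      (ij.1.centralBinom : ℂ) * (ij.2.centralBinom : ℂ) = 4 ^ n := by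
  let F : PowerSeries ℂ := PowerSeries.mk fun n => (n.centralBinom : ℂ)
  have hF : PowerSeries.derivative ℂ F * (1 - 4 * PowerSeries.X) = 2 * F := by
    ext n
    have h4 : PowerSeries.derivative ℂ F * (1 - 4 * PowerSeries.X)
        = PowerSeries.derivative ℂ F
          - PowerSeries.C 4 * (PowerSeries.derivative ℂ F * PowerSeries.X) := by
      rw [map_ofNat]; ring
    have h2 : 2 * F = PowerSeries.C 2 * F := by rw [map_ofNat]
    rw [h4, h2, map_sub, PowerSeries.coeff_C_mul, PowerSeries.coeff_C_mul]
    have hc : ∀ n : ℕ, ((n : ℂ) + 1) * ((n + 1).centralBinom : ℂ)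
        = 2 * (2 * n + 1) * (n.centralBinom : ℂ) := fun n => by
      exact_mod_cast Nat.succ_mul_centralBinom_succ n
    cases n with
    | zero =>
      have := hc 0
      simp only [PowerSeries.coeff_zero_mul_X, PowerSeries.coeff_derivative, F,
        PowerSeries.coeff_mk]
      linear_combination this
    | succ n =>
      have := hc (n + 1)
      simp only [PowerSeries.coeff_succ_mul_X, PowerSeries.coeff_derivative, F,
        PowerSeries.coeff_mk]
      push_cast at this ⊢
      linear_combination this
  have hG : F ^ 2 * (1 - 4 * PowerSeries.X) = 1 := by
    have d4 : PowerSeries.derivative ℂ (4 : PowerSeries ℂ) = 0 := by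
      rw [← map_ofNat (PowerSeries.C (R := ℂ)) 4, PowerSeries.derivative_C]
    refine PowerSeries.derivative.ext ?_ ?_
    · rw [Derivation.leibniz, Derivation.leibniz_pow, map_sub, Derivation.leibniz, d4]
      simp only [PowerSeries.derivative_one, PowerSeries.derivative_X, smul_eq_mul, nsmul_eq_mul]
      push_cast
      linear_combination 2 * F * hF
    · simp [F]
  have h := congrArg (fun f => f * PowerSeries.mk fun n => (4 : ℂ) ^ n) hG
  have hgeom : (1 - 4 * PowerSeries.X) * (PowerSeries.mk fun n => (4 : ℂ) ^ n) = 1 := by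
    rw [sub_mul, one_mul, sub_eq_iff_eq_add, ← map_ofNat (PowerSeries.C (R := ℂ)) 4, mul_assoc]
    ext n
    cases n with
    | zero => simp
    | succ n =>
      rw [map_add, PowerSeries.coeff_C_mul, PowerSeries.coeff_succ_X_mul]
      simp [PowerSeries.coeff_one, pow_succ']
  simp only [mul_assoc, hgeom, mul_one, one_mul] at h
  have := congrArg (PowerSeries.coeff n) h
  rw [pow_two, PowerSeries.coeff_mul] at this
  simpa [F] using this

/-- Where the derivation vanishes, `L_n[u]` is `binom(2n, n) / 2 * u ^ n`. -/
theorem evalDiff_zero_lenard {A : Type*} [CommRing A] [Algebra ℂ A] (u : A) (n : ℕ) :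
    evalDiff (0 : Derivation ℂ A A) u (lenard n)
      = algebraMap ℂ A ((n.centralBinom : ℂ) / 2) * u ^ n := by
  induction n using Nat.strong_induction_on with
  | _ n ih =>
    cases n with
    | zero => rw [lenard, evalDiff_C]; simp
    | succ n =>
      have hD : ∀ P, evalDiff (0 : Derivation ℂ A A) u (totalDeriv P) = 0 := fun P => by
        induction P using MvPolynomial.induction_on with
        | C a => simp [totalDeriv, MvPolynomial.derivation_C]
        | add p q hp hq => simp [hp, hq]
        | mul_X p k hp =>
          rw [Derivation.leibniz, map_add, smul_eq_mul, smul_eq_mul, map_mul, map_mul, hp, mul_zero,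
            add_zero, totalDeriv, MvPolynomial.mkDerivation_X, evalDiff_X,
            Function.iterate_succ_apply']
          simp
      -- The Lenard recursion without its derivative terms. It is the convolution identity at `n`
      -- and `n + 1`, the two end terms of the latter being split off.
      have key : ((n + 1).centralBinom : ℂ) / 2
          = 4 * ∑ i : Fin (n + 1), ((i : ℕ).centralBinom / 2 : ℂ) * ((n - i).centralBinom / 2 : ℂ)
            - ∑ i : Fin n, ((i + 1 : ℕ).centralBinom / 2 : ℂ) * ((n - i).centralBinom / 2 : ℂ) := by
        have h1 := sum_centralBinom_mul_centralBinom n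
        have h2 := sum_centralBinom_mul_centralBinom (n + 1)
        rw [Finset.Nat.sum_antidiagonal_eq_sum_range_succ_mk] at h1 h2
        rw [Finset.sum_range_succ', Finset.sum_range_succ] at h2
        simp only [Nat.sub_self, Nat.sub_zero, Nat.add_sub_add_right, Nat.centralBinom_zero,
          Nat.cast_one, one_mul, mul_one] at h1 h2
        rw [Fin.sum_univ_eq_sum_range
            (fun i => (i.centralBinom / 2 : ℂ) * ((n - i).centralBinom / 2 : ℂ)),
          Fin.sum_univ_eq_sum_range
            (fun i => ((i + 1).centralBinom / 2 : ℂ) * ((n - i).centralBinom / 2 : ℂ))]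
        simp only [div_mul_div_comm, ← Finset.sum_div]
        rw [h1]
        rw [pow_succ] at h2
        linear_combination h2 / 4
      rw [lenard, key]
      simp only [map_sub, map_mul, map_add, map_sum, map_ofNat, hD, mul_zero, sub_zero, zero_add,
        evalDiff_X, Function.iterate_zero, id_eq]
      rw [sub_mul, Finset.sum_mul, mul_assoc 4, Finset.sum_mul, Finset.mul_sum, Finset.mul_sum]
      congr 1
      · refine Finset.sum_congr rfl fun ⟨i, hi⟩ _ => ?_
        dsimp only
        rw [ih i hi, ih (n - i) (by omega)]
        obtain ⟨j, hj⟩ : ∃ j, n = i + j := ⟨n - i, by omega⟩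
        have : n - i = j := by omega
        rw [this, hj]
        ring
      · refine Finset.sum_congr rfl fun ⟨i, hi⟩ _ => ?_
        dsimp only
        rw [ih (i + 1) (by omega), ih (n - i) (by omega)]
        obtain ⟨j, hj⟩ : ∃ j, n = i + j := ⟨n - i, by omega⟩
        have : n - i = j := by omega
        rw [this, hj]
        ring

/-! ### The expansion at infinity of a solution decaying at infinity

Power series in `X = 1 / z` are used; the derivation `d/dz` becomes `-X² d/dX`. -/

section Expansion

variable {R S : Type*} [CommRing R] [Algebra ℂ R] [CommRing S] [Algebra ℂ S]

/-- The derivation `δ d/dz` on power series in `1 / z`. -/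
def invDeriv (δ : R) : Derivation ℂ (PowerSeries R) (PowerSeries R) :=
  (PowerSeries.C (-δ) * PowerSeries.X ^ 2) • (PowerSeries.derivative R).restrictScalars ℂ

theorem invDeriv_apply (δ : R) (f : PowerSeries R) :
    invDeriv δ f = PowerSeries.C (-δ) * PowerSeries.X ^ 2 * PowerSeries.derivative R f := rfl

theorem coeff_invDeriv (δ : R) (f : PowerSeries R) (n : ℕ) :
    PowerSeries.coeff n (invDeriv δ f)
      = -δ * if 2 ≤ n then PowerSeries.coeff (n - 2 + 1) f * ((n - 2 : ℕ) + 1) else 0 := by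
  rw [invDeriv_apply, mul_assoc, PowerSeries.coeff_C_mul, PowerSeries.coeff_X_pow_mul',
    PowerSeries.coeff_derivative]

/-- Differentiation lowers the order by at most one, and the factor `X²` more than makes up for it.
-/
theorem invDeriv_mem (δ : R) (k : ℕ) (f : PowerSeries R)
    (hf : f ∈ Ideal.span {(PowerSeries.X : PowerSeries R) ^ k}) :
    invDeriv δ f ∈ Ideal.span {(PowerSeries.X : PowerSeries R) ^ k} := by
  rw [Ideal.mem_span_singleton] at hf ⊢
  obtain ⟨g, rfl⟩ := hf
  rw [invDeriv_apply, Derivation.leibniz, Derivation.leibniz_pow, PowerSeries.derivative_X]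
  cases k with
  | zero => simp
  | succ k =>
    simp only [smul_eq_mul, nsmul_eq_mul, Nat.add_sub_cancel, mul_one]
    exact ⟨PowerSeries.C (-δ) * PowerSeries.X ^ 2 * PowerSeries.derivative R g
      + PowerSeries.C (-δ) * PowerSeries.X * g * ((k + 1 : ℕ) : PowerSeries R), by ring⟩

/-- The `k`-th approximation to the solution `w = O(1/z)` of `z w = (δ d/dz + 2w) L_N - β`. -/
def approxSol (N : ℕ) (β δ : R) : ℕ → PowerSeries R
  | 0 => 0
  | k + 1 => PowerSeries.X
      * (hierarchyOp N (invDeriv δ) (approxSol N β δ k) - PowerSeries.C β)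

theorem approxSol_succ (N : ℕ) (β δ : R) (k : ℕ) :
    approxSol N β δ (k + 1) = PowerSeries.X
      * (hierarchyOp N (invDeriv δ) (approxSol N β δ k) - PowerSeries.C β) := rfl

/-- A solution agrees with its `k`-th approximation up to the order `k`. -/
theorem sub_approxSol_mem (N : ℕ) (β δ : R) (w : PowerSeries R)
    (hw : w = PowerSeries.X * (hierarchyOp N (invDeriv δ) w - PowerSeries.C β)) (k : ℕ) :
    w - approxSol N β δ k ∈ Ideal.span {(PowerSeries.X : PowerSeries R) ^ k} := by
  induction k with
  | zero => simp
  | succ k ih =>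
    have h := hierarchyOp_sub_mem N (invDeriv δ) _ (invDeriv_mem δ k) ih
    rw [Ideal.mem_span_singleton] at h ⊢
    have h2 := mul_dvd_mul_left (PowerSeries.X : PowerSeries R) h
    rw [← pow_succ'] at h2
    convert h2 using 1
    rw [approxSol_succ]
    nth_rewrite 1 [hw]
    ring

/-- Uniqueness of the solution: each coefficient depends on `N`, `β` and `δ` alone. -/
theorem coeff_eq_coeff_approxSol (N : ℕ) (β δ : R) (w : PowerSeries R)
    (hw : w = PowerSeries.X * (hierarchyOp N (invDeriv δ) w - PowerSeries.C β)) {j k : ℕ}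
    (hjk : j < k) : PowerSeries.coeff j w = PowerSeries.coeff j (approxSol N β δ k) := by
  have h := sub_approxSol_mem N β δ w hw k
  rw [Ideal.mem_span_singleton, PowerSeries.X_pow_dvd_iff] at h
  have := h j hjk
  rwa [map_sub, sub_eq_zero] at this

/-- Taking `β` or `δ` to be a polynomial variable and `φ` an evaluation shows that the coefficients
are polynomial in that parameter. -/
theorem map_approxSol (N : ℕ) (φ : R →ₐ[ℂ] S) (β δ : R) (k : ℕ) :
    PowerSeries.map (φ : R →+* S) (approxSol N β δ k) = approxSol N (φ β) (φ δ) k := by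
  have hφ : ∀ x : PowerSeries R, PowerSeries.mapAlgHom φ (invDeriv δ x)
      = invDeriv (φ δ) (PowerSeries.mapAlgHom φ x) := fun x => by
    ext n
    rw [PowerSeries.mapAlgHom_apply, PowerSeries.mapAlgHom_apply, PowerSeries.coeff_map,
      coeff_invDeriv, coeff_invDeriv, PowerSeries.coeff_map]
    split_ifs <;> simp
  induction k with
  | zero => simp [approxSol]
  | succ k ih =>
    have hH := map_hierarchyOp N (PowerSeries.mapAlgHom φ) (invDeriv δ) (invDeriv (φ δ)) hφ
      (approxSol N β δ k)
    rw [PowerSeries.mapAlgHom_apply, PowerSeries.mapAlgHom_apply] at hH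
    have ih' : PowerSeries.map φ (approxSol N β δ k) = approxSol N (φ β) (φ δ) k := ih
    rw [ih'] at hH
    rw [approxSol_succ, map_mul, map_sub, approxSol_succ, PowerSeries.map_X, PowerSeries.map_C]
    congr 2

end Expansion

/-- The scaling symmetry `z ↦ e^(2N) z`, `w ↦ w / e` of the hierarchy. -/
theorem approxSol_scaling (N : ℕ) {e : ℂ} (he : e ≠ 0) (k : ℕ) :
    approxSol N (e ^ (2 * N + 1)) 1 k
      = e • PowerSeries.rescale (e ^ (2 * N)) (approxSol N 1 (e⁻¹ ^ (2 * N + 1)) k) := by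
  have hr : ∀ x : PowerSeries ℂ, PowerSeries.rescaleAlgHom (e ^ (2 * N)) x
      = PowerSeries.rescale (e ^ (2 * N)) x := fun x =>
    DFunLike.congr_fun (PowerSeries.coe_rescaleAlgHom (e ^ (2 * N))) x
  have hg : ∀ x : PowerSeries ℂ,
      PowerSeries.rescaleAlgHom (e ^ (2 * N)) ((e • invDeriv (e⁻¹ ^ (2 * N + 1))) x)
        = invDeriv 1 (PowerSeries.rescaleAlgHom (e ^ (2 * N)) x) := fun x => by
    ext n
    rw [hr, hr, Derivation.smul_apply, PowerSeries.coeff_rescale, PowerSeries.coeff_smul,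
      coeff_invDeriv, coeff_invDeriv, PowerSeries.coeff_rescale, smul_eq_mul]
    split_ifs with hn
    · obtain ⟨m, rfl⟩ := Nat.exists_eq_add_of_le' hn
      have : e ^ (2 * N) * (e * e⁻¹ ^ (2 * N + 1)) = 1 := by
        rw [inv_pow]
        field_simp
        ring
      rw [Nat.add_sub_cancel]
      linear_combination (-(e ^ (2 * N)) ^ (m + 1) * PowerSeries.coeff (m + 1) x * (m + 1)) * this
    · simp
  induction k with
  | zero => simp [approxSol]
  | succ k ih =>
    have hH := map_hierarchyOp N (PowerSeries.rescaleAlgHom (e ^ (2 * N))) _ _ hg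
      (e • approxSol N 1 (e⁻¹ ^ (2 * N + 1)) k)
    -- Homogeneity pulls out `e^(2N+1)`. This equals both the new `β` and the factor `e * e^(2N)`
    -- that the prefactor and the rescaling of the outer `X` produce.
    rw [hierarchyOp_smul, map_smul, map_smul, hr, hr, ← ih] at hH
    rw [approxSol_succ, ← hH, approxSol_succ, map_mul, map_sub, PowerSeries.rescale_X]
    have h1 : PowerSeries.rescale (e ^ (2 * N)) (PowerSeries.C (1 : ℂ)) = 1 := by simp
    rw [h1]
    simp only [PowerSeries.smul_eq_C_mul, map_pow]
    ring

/-! ### The leading coefficients -/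

/-- Approximations to the generating series `Z = 1 + X ^ m * Z ^ m` of the Fuss–Catalan numbers. -/
def fussCatalanApprox (m : ℕ) : ℕ → PowerSeries ℕ
  | 0 => 1
  | k + 1 => 1 + PowerSeries.X ^ m * fussCatalanApprox m k ^ m

theorem constantCoeff_fussCatalanApprox {m : ℕ} (hm : m ≠ 0) (k : ℕ) :
    PowerSeries.constantCoeff (fussCatalanApprox m k) = 1 := by
  cases k <;> simp [fussCatalanApprox, hm]

/-- Over `ℕ` nothing cancels: a positive power of a series with constant term 1 dominates the series
coefficientwise, and each iteration shifts this bound by `X^m`. -/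
theorem one_le_coeff_fussCatalanApprox {m : ℕ} (hm : m ≠ 0) {l k : ℕ} (hlk : l ≤ k) :
    1 ≤ PowerSeries.coeff (m * l) (fussCatalanApprox m k) := by
  have hpow : ∀ (f : PowerSeries ℕ), PowerSeries.constantCoeff f = 1 → ∀ n j : ℕ,
      PowerSeries.coeff j f ≤ PowerSeries.coeff j (f ^ (n + 1)) := by
    intro f hf n j
    induction n with
    | zero => simp
    | succ n ih =>
      rw [pow_succ _ (n + 1), PowerSeries.coeff_mul]
      refine ih.trans ?_
      have := Finset.single_le_sum (f := fun ij : ℕ × ℕ =>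
        PowerSeries.coeff ij.1 (f ^ (n + 1)) * PowerSeries.coeff ij.2 f)
        (fun _ _ => Nat.zero_le _)
        (show (j, 0) ∈ Finset.HasAntidiagonal.antidiagonal j by simp)
      simpa [hf] using this
  induction k generalizing l with
  | zero =>
    obtain rfl : l = 0 := by omega
    simp [fussCatalanApprox]
  | succ k ih =>
    cases l with
    | zero =>
      rw [mul_zero, PowerSeries.coeff_zero_eq_constantCoeff_apply,
        constantCoeff_fussCatalanApprox hm]
    | succ l =>
      rw [fussCatalanApprox, map_add, Nat.mul_succ, PowerSeries.coeff_X_pow_mul]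
      obtain ⟨n, rfl⟩ := Nat.exists_eq_succ_of_ne_zero hm
      refine le_trans ((ih (by omega : l ≤ k)).trans
        (hpow _ (constantCoeff_fussCatalanApprox hm k) n _)) (Nat.le_add_left _ _)

/-- Without derivatives the equation is `w = X ((-1)^N binom(2N, N) w^(2N+1) - 1)`. The root `μ`
absorbs the constant, leaving `w = -X Z(μX)` with `Z = 1 + X^(2N+1) Z^(2N+1)`; the iterations
correspond step by step. -/
theorem approxSol_dispersionless (N : ℕ) {μ : ℂ}
    (hμ : μ ^ (2 * N + 1) = (-1) ^ N * (N.centralBinom : ℂ)) (k : ℕ) :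
    approxSol N (1 : ℂ) 0 (k + 1) = -(PowerSeries.X * PowerSeries.rescale μ
      (PowerSeries.map (Nat.castRingHom ℂ) (fussCatalanApprox (2 * N + 1) k))) := by
  have hD : invDeriv (0 : ℂ) = 0 := by
    ext1 f
    simp [invDeriv_apply]
  have hH : ∀ v : PowerSeries ℂ, hierarchyOp N (invDeriv (0 : ℂ)) v
      = PowerSeries.C μ ^ (2 * N + 1) * v ^ (2 * N + 1) := fun v => by
    rw [hD, hierarchyOp, evalDiff_zero_lenard, ← map_pow, hμ, Derivation.coe_zero]
    have h2 : (2 : PowerSeries ℂ) * algebraMap ℂ (PowerSeries ℂ) ((N.centralBinom : ℂ) / 2)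
        = PowerSeries.C (N.centralBinom : ℂ) := by
      rw [← map_ofNat (algebraMap ℂ (PowerSeries ℂ)) 2, ← map_mul, mul_div_cancel₀ _ two_ne_zero]
      rfl
    simp only [Pi.zero_apply, zero_sub, zero_add, map_mul, map_pow, map_neg, map_one]
    rw [neg_pow (v ^ 2), pow_succ v (2 * N), pow_mul]
    linear_combination ((-1) ^ N * (v ^ 2) ^ N * v) * h2
  induction k with
  | zero =>
    rw [approxSol_succ, hH]
    simp [approxSol, fussCatalanApprox]
  | succ k ih =>
    rw [approxSol_succ, hH, ih]
    simp only [fussCatalanApprox, map_add, map_mul, map_one, map_pow, PowerSeries.map_X,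
      PowerSeries.rescale_X]
    rw [Odd.neg_pow ⟨N, rfl⟩]
    ring

theorem coeff_approxSol_dispersionless_ne_zero (N l : ℕ) {k : ℕ} (hlk : l < k) :
    PowerSeries.coeff ((2 * N + 1) * l + 1) (approxSol N (1 : ℂ) 0 k) ≠ 0 := by
  obtain ⟨μ, hμ⟩ := IsAlgClosed.exists_pow_nat_eq ((-1) ^ N * (N.centralBinom : ℂ))
    (Nat.succ_pos (2 * N))
  have hμ0 : μ ≠ 0 := by
    rintro rfl
    rw [zero_pow (Nat.succ_ne_zero _)] at hμ
    have : (N.centralBinom : ℂ) ≠ 0 := by exact_mod_cast N.centralBinom_ne_zero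
    exact mul_ne_zero (pow_ne_zero _ (by norm_num)) this hμ.symm
  obtain ⟨k, rfl⟩ : ∃ j, k = j + 1 := ⟨k - 1, by omega⟩
  rw [approxSol_dispersionless N hμ, map_neg, PowerSeries.coeff_succ_X_mul,
    PowerSeries.coeff_rescale, PowerSeries.coeff_map, neg_ne_zero]
  refine mul_ne_zero (pow_ne_zero _ hμ0) ?_
  have := one_le_coeff_fussCatalanApprox (Nat.succ_ne_zero (2 * N)) (by omega : l ≤ k)
  rw [eq_natCast, Nat.cast_ne_zero]
  exact Nat.one_le_iff_ne_zero.1 this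

/-- The coefficient of `z ^ (-1 - (2N+1) l)` in the expansion at infinity of a solution, as a
polynomial in the parameter `α`. -/
def expansionCoeff (N l : ℕ) : ℂ[X] :=
  -- The order `(2N+1) l + 2` is the least for which `coeff_eq_coeff_approxSol` covers this
  -- coefficient.
  PowerSeries.coeff ((2 * N + 1) * l + 1) (approxSol N (X : ℂ[X]) 1 ((2 * N + 1) * l + 2))

theorem eval_expansionCoeff (N l : ℕ) (α : ℂ) :
    (expansionCoeff N l).eval α
      = PowerSeries.coeff ((2 * N + 1) * l + 1) (approxSol N α 1 ((2 * N + 1) * l + 2)) := by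
  have := map_approxSol N (aeval α : ℂ[X] →ₐ[ℂ] ℂ) X 1 ((2 * N + 1) * l + 2)
  rw [aeval_X, map_one] at this
  rw [← this, PowerSeries.coeff_map, expansionCoeff]
  simp

/-- Scaling identifies this polynomial with `α^M b(1/α)`, where `b` is the same coefficient with `β
= 1` and `δ` as the variable. Its degree is `M` because `b(0)`, the dispersionless coefficient, is
nonzero. -/
theorem natDegree_expansionCoeff (N l : ℕ) :
    (expansionCoeff N l).natDegree = 2 * N * l + 1 := by
  set M := 2 * N * l + 1 with hM
  set b : ℂ[X] := PowerSeries.coeff ((2 * N + 1) * l + 1)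
    (approxSol N (1 : ℂ[X]) X ((2 * N + 1) * l + 2)) with hb
  have evb : ∀ δ : ℂ, b.eval δ
      = PowerSeries.coeff ((2 * N + 1) * l + 1) (approxSol N 1 δ ((2 * N + 1) * l + 2)) := by
    intro δ
    have := map_approxSol N (aeval δ : ℂ[X] →ₐ[ℂ] ℂ) 1 X ((2 * N + 1) * l + 2)
    rw [aeval_X, map_one] at this
    rw [← this, PowerSeries.coeff_map, hb]
    simp
  have hb0 : b.coeff 0 ≠ 0 := by
    rw [coeff_zero_eq_eval_zero, evb]
    refine coeff_approxSol_dispersionless_ne_zero N l ?_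
    nlinarith [Nat.zero_le (N * l)]
  have hne : b ≠ 0 := fun h => hb0 (by simp [h])
  -- The relation with `b(1/α)`, cleared of denominators so that no bound on `deg b` is needed; it
  -- suffices to check it for `α ≠ 0`, with `α = e^(2N+1)`.
  have hrev : expansionCoeff N l * X ^ b.natDegree = b.reverse * X ^ M := by
    refine eq_of_infinite_eval_eq _ _ (Set.Infinite.mono (s := {0}ᶜ) ?_
      (Set.finite_singleton (0 : ℂ)).infinite_compl)
    intro α hα
    have hα0 : α ≠ 0 := hα
    obtain ⟨e, he⟩ := IsAlgClosed.exists_pow_nat_eq α (Nat.succ_pos (2 * N))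
    have he0 : e ≠ 0 := by
      rintro rfl
      rw [zero_pow (Nat.succ_ne_zero _)] at he
      exact hα0 he.symm
    have h1 : (expansionCoeff N l).eval α = α ^ M * b.eval α⁻¹ := by
      rw [eval_expansionCoeff, evb, ← he, approxSol_scaling N he0, PowerSeries.coeff_smul,
        PowerSeries.coeff_rescale, smul_eq_mul, ← mul_assoc, ← inv_pow, hM]
      congr 1
      rw [← pow_mul, ← pow_mul, ← pow_succ']
      congr 1
      rw [Nat.succ_eq_add_one]
      ring
    have h2 : α ^ b.natDegree * b.eval α⁻¹ = b.reverse.eval α := by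
      let _ : Invertible α⁻¹ := invertibleOfNonzero (inv_ne_zero hα0)
      have h3 := eval₂_reverse_mul_pow (RingHom.id ℂ) α⁻¹ b
      rw [invOf_eq_inv, inv_inv] at h3
      change b.reverse.eval α * α⁻¹ ^ b.natDegree = b.eval α⁻¹ at h3
      rw [← h3, mul_left_comm, ← mul_pow, mul_inv_cancel₀ hα0, one_pow, mul_one]
    simp only [Set.mem_ofPred_eq, eval_mul, eval_pow, eval_X]
    rw [h1, ← h2]
    ring
  -- Since `b(0) ≠ 0`, reversal keeps the degree, so `deg b` cancels when degrees are compared in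
  -- `hrev`.
  have hrd : b.reverse.natDegree = b.natDegree := by
    rw [reverse_natDegree, natTrailingDegree_eq_zero.2 (Or.inr hb0), Nat.sub_zero]
  have ha0 : expansionCoeff N l ≠ 0 := by
    intro h
    rw [h, zero_mul] at hrev
    exact mul_ne_zero (by simpa using hne) (pow_ne_zero M X_ne_zero) hrev.symm
  have := congrArg natDegree hrev
  rw [natDegree_mul ha0 (pow_ne_zero _ X_ne_zero),
    natDegree_mul (by simpa using hne) (pow_ne_zero M X_ne_zero), natDegree_X_pow, natDegree_X_pow,
    hrd] at this
  omega

/-! ### Laurent expansions at infinity -/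

section LaurentExpansion

/-- The coefficientwise algebra structure, which must take precedence over the one induced by
power series. -/
local instance (priority := 2000) laurentAlgebra : Algebra ℂ (LaurentSeries ℂ) :=
  HahnSeries.instAlgebra

/-- The Euler derivation `z d/dz` on Laurent series in `1 / z`. -/
def eulerDeriv : Derivation ℂ (LaurentSeries ℂ) (LaurentSeries ℂ) :=
  Derivation.mk'
    { toFun := fun f =>
        { coeff := fun k => -(k : ℂ) * f.coeff k
          isPWO_support' := f.isPWO_support.mono fun k hk hf => hk (by
            change -(k : ℂ) * f.coeff k = 0
            rw [hf, mul_zero]) }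
      map_add' := fun f g => by
        ext k
        simp [mul_add]
      map_smul' := fun c f => by
        ext k
        simp [mul_left_comm] }
    (fun f g => by
      ext k
      simp only [LinearMap.coe_mk, AddHom.coe_mk, smul_eq_mul, HahnSeries.coeff_add]
      -- The sums for the three products are put over the same index set, built from the supports of
      -- `f` and `g`; the Leibniz rule is then `i + j = k` term by term.
      rw [mul_comm g, HahnSeries.coeff_mul,
        HahnSeries.coeff_mul_right' g.isPWO_support fun k hk hf => hk (by
            change -(k : ℂ) * g.coeff k = 0
            rw [hf, mul_zero]),
        HahnSeries.coeff_mul_left' f.isPWO_support fun k hk hf => hk (by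
            change -(k : ℂ) * f.coeff k = 0
            rw [hf, mul_zero]), Finset.mul_sum, ← Finset.sum_add_distrib]
      refine Finset.sum_congr rfl fun ij hij => ?_
      have h : ij.1 + ij.2 = k := by
        simpa using (Finset.mem_antidiagonal.1 hij).2.2
      rw [← h]
      push_cast
      ring)

/-- The derivation `d/dz` on Laurent series in `1 / z`. -/
def laurentDeriv : Derivation ℂ (LaurentSeries ℂ) (LaurentSeries ℂ) :=
  (HahnSeries.single (1 : ℤ) (1 : ℂ) : LaurentSeries ℂ) • eulerDeriv

theorem coeff_laurentDeriv (f : LaurentSeries ℂ) (k : ℤ) :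
    (laurentDeriv f).coeff k = -((k - 1 : ℤ) : ℂ) * f.coeff (k - 1) := by
  change (HahnSeries.single (1 : ℤ) (1 : ℂ) * eulerDeriv f).coeff k = _
  rw [HahnSeries.coeff_single_mul, one_mul]
  rfl

/-- The inclusion of power series in `1 / z` into Laurent series in `1 / z`. -/
def toLaurent : PowerSeries ℂ →ₐ[ℂ] LaurentSeries ℂ := HahnSeries.ofPowerSeriesAlg ℤ ℂ

theorem toLaurent_injective : Function.Injective toLaurent :=
  HahnSeries.ofPowerSeries_injective (Γ := ℤ) (R := ℂ)

theorem toLaurent_X : toLaurent PowerSeries.X = HahnSeries.single 1 1 :=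
  HahnSeries.ofPowerSeries_X

theorem coeff_toLaurent (f : PowerSeries ℂ) (k : ℤ) :
    (toLaurent f).coeff k = if k < 0 then 0 else PowerSeries.coeff k.natAbs f :=
  PowerSeries.coeff_coe f k

theorem toLaurent_invDeriv (f : PowerSeries ℂ) :
    toLaurent (invDeriv 1 f) = laurentDeriv (toLaurent f) := by
  ext k
  rw [coeff_laurentDeriv, coeff_toLaurent, coeff_toLaurent, coeff_invDeriv]
  rcases lt_or_ge k 0 with hk | hk
  · rw [if_pos hk, if_pos (by omega), mul_zero]
  · obtain ⟨n, rfl⟩ := Int.eq_ofNat_of_zero_le hk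
    rw [if_neg (by omega)]
    match n with
    | 0 => simp
    | 1 => simp
    | n + 2 =>
      have h : ((n + 2 : ℕ) : ℤ) - 1 = ((n + 1 : ℕ) : ℤ) := by push_cast; ring
      rw [h, if_pos (by rw [Int.natAbs_natCast]; omega), if_neg (by omega)]
      simp only [Int.natAbs_natCast, Nat.add_sub_cancel]
      push_cast
      ring

/-- The expansion at infinity of a polynomial. -/
def polyExpansion : ℂ[X] →ₐ[ℂ] LaurentSeries ℂ := aeval (HahnSeries.single (-1) 1)

theorem coeff_polyExpansion (P : ℂ[X]) (k : ℕ) :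
    (polyExpansion P).coeff (-(k : ℤ)) = P.coeff k := by
  induction P using Polynomial.induction_on' with
  | add p q hp hq => rw [map_add, HahnSeries.coeff_add, hp, hq, coeff_add]
  | monomial n a =>
    rw [polyExpansion, aeval_monomial, HahnSeries.single_pow, one_pow, ← Algebra.smul_def,
      HahnSeries.coeff_smul, HahnSeries.coeff_single, coeff_monomial]
    by_cases h : n = k
    · simp [h]
    · rw [if_neg h, if_neg (by simp; omega), smul_zero]

theorem polyExpansion_injective : Function.Injective polyExpansion := by
  intro P Q h
  ext k
  rw [← coeff_polyExpansion, h, coeff_polyExpansion]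

theorem laurentDeriv_z : laurentDeriv (HahnSeries.single (-1) 1) = 1 := by
  ext k
  rw [coeff_laurentDeriv, HahnSeries.coeff_single, HahnSeries.coeff_one]
  by_cases h : k = 0
  · simp [h]
  · rw [if_neg h, if_neg (by omega), mul_zero]

theorem polyExpansion_derivative (P : ℂ[X]) :
    polyExpansion (derivative P) = laurentDeriv (polyExpansion P) := by
  rw [polyExpansion, Derivation.map_aeval, laurentDeriv_z, smul_eq_mul, mul_one]

/-- The expansion at infinity of a rational function. -/
def expansion : RatFunc ℂ →ₐ[ℂ] LaurentSeries ℂ :=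
  RatFunc.liftAlgHom polyExpansion
    (nonZeroDivisors_le_comap_nonZeroDivisors_of_injective _ polyExpansion_injective)

theorem expansion_algebraMap (P : ℂ[X]) :
    expansion (algebraMap ℂ[X] (RatFunc ℂ) P) = polyExpansion P := by
  have := RatFunc.liftAlgHom_apply_div polyExpansion
    (nonZeroDivisors_le_comap_nonZeroDivisors_of_injective _ polyExpansion_injective) P 1
  rw [map_one, map_one, div_one, div_one] at this
  exact this

/-- `ratDeriv` is the quotient rule for numerator and denominator, which `laurentDeriv` satisfies as
a derivation of a field. Derivation laws for `ratDeriv` itself are thus never needed. -/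
theorem expansion_ratDeriv (f : RatFunc ℂ) :
    expansion (ratDeriv f) = laurentDeriv (expansion f) := by
  have hd : polyExpansion f.denom ≠ 0 := fun h =>
    f.denom_ne_zero (polyExpansion_injective (by rw [h, map_zero]))
  conv_rhs => rw [← RatFunc.num_div_denom f]
  rw [ratDeriv, map_div₀, map_div₀, map_pow, expansion_algebraMap, expansion_algebraMap,
    expansion_algebraMap, Derivation.leibniz_div, map_sub, map_mul, map_mul,
    polyExpansion_derivative, polyExpansion_derivative]
  simp only [smul_eq_mul]
  field_simp

theorem expansion_evalAt (P : DiffPoly) (u : RatFunc ℂ) :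
    expansion (P.evalAt u) = evalDiff laurentDeriv (expansion u) P := by
  have hk : ∀ k : ℕ, expansion (ratDeriv^[k] u) = laurentDeriv^[k] (expansion u) := fun k =>
    (Function.Semiconj.iterate_right (f := expansion) expansion_ratDeriv k) u
  rw [DiffPoly.evalAt, evalDiff, ← AlgHom.comp_apply, MvPolynomial.comp_aeval]
  simp only [hk]

theorem expansion_painleveTwo (N : ℕ) (w : RatFunc ℂ) (α : ℂ) :
    expansion (painleveTwo N w α) = hierarchyOp N laurentDeriv (expansion w)
      - HahnSeries.single (-1) 1 * expansion w - algebraMap ℂ (LaurentSeries ℂ) α := by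
  have hX : expansion RatFunc.X = HahnSeries.single (-1) 1 := by
    rw [← RatFunc.algebraMap_X, expansion_algebraMap, polyExpansion, aeval_X]
  have hC : expansion (RatFunc.C α) = algebraMap ℂ (LaurentSeries ℂ) α := by
    rw [← RatFunc.algebraMap_C, expansion_algebraMap, polyExpansion, aeval_C]
  simp only [painleveTwo, hierarchyOp, map_sub, map_add, map_mul, map_pow, map_ofNat,
    expansion_ratDeriv, expansion_evalAt, hX, hC]

theorem single_neg_one_mul_toLaurent_X :
    (HahnSeries.single (-1) 1 : LaurentSeries ℂ) * toLaurent PowerSeries.X = 1 := by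
  rw [toLaurent_X, HahnSeries.single_mul_single]
  simp

/-- The expansion at infinity of the logarithmic derivative of `∏ (X - a)`. -/
theorem laurentDeriv_polyExpansion_prod (s : Multiset ℂ) :
    laurentDeriv (polyExpansion (s.map fun a => X - C a).prod)
      = polyExpansion (s.map fun a => X - C a).prod * toLaurent
        (PowerSeries.X * PowerSeries.mk fun m => (s.map fun a => a ^ m).sum) := by
  induction s using Multiset.induction_on with
  | empty =>
    have h0 : (PowerSeries.mk fun _ => (0 : ℂ)) = 0 := by ext; simp
    simp [h0]
  | cons a s ih =>
    have hsplit : (PowerSeries.mk fun m => ((a ::ₘ s).map fun a => a ^ m).sum)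
        = PowerSeries.mk (fun m => a ^ m)
          + PowerSeries.mk fun m => (s.map fun a => a ^ m).sum := by
      ext m
      simp
    have hgeom : PowerSeries.mk (fun m => a ^ m)
        - PowerSeries.C a * (PowerSeries.X * PowerSeries.mk fun m => a ^ m) = 1 := by
      ext n
      rw [map_sub, PowerSeries.coeff_C_mul]
      cases n with
      | zero => simp
      | succ n =>
        rw [PowerSeries.coeff_succ_X_mul]
        simp [PowerSeries.coeff_one, pow_succ']
    -- The expansion `1 / (z - a) = ∑ a^m z^(-m-1)`.
    have h1 : polyExpansion (X - C a) * toLaurent (PowerSeries.X * PowerSeries.mk fun m => a ^ m)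
        = 1 := by
      have hCa : polyExpansion (C a) = toLaurent (PowerSeries.C a) :=
        (polyExpansion.commutes a).trans (toLaurent.commutes a).symm
      rw [map_sub, sub_mul, map_mul, ← mul_assoc, polyExpansion, aeval_X,
        single_neg_one_mul_toLaurent_X, one_mul, ← polyExpansion, hCa, ← map_mul, ← map_mul,
        ← map_sub, hgeom, map_one]
    have h2 : laurentDeriv (polyExpansion (X - C a)) = 1 := by
      rw [← polyExpansion_derivative, derivative_X_sub_C, map_one]
    rw [hsplit, Multiset.map_cons, Multiset.prod_cons, map_mul, Derivation.leibniz, ih, h2,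
      mul_add, map_add, smul_eq_mul, smul_eq_mul]
    linear_combination (-polyExpansion (s.map fun a => X - C a).prod) * h1

/-- The generating series `∑ s_m / z ^ (m + 1)` of the power sums of the roots of `P`. -/
def powerSumSeries (P : ℂ[X]) : PowerSeries ℂ :=
  PowerSeries.X * PowerSeries.mk fun m => rootPowerSum P m

theorem prod_roots_eq {P : ℂ[X]} (hP : P.Monic) : (P.roots.map fun a => X - C a).prod = P :=
  prod_multiset_X_sub_C_of_monic_of_roots_card_eq hP
    (splits_iff_card_roots.1 (IsAlgClosed.splits P))

theorem laurentDeriv_polyExpansion {P : ℂ[X]} (hP : P.Monic) :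
    laurentDeriv (polyExpansion P) = polyExpansion P * toLaurent (powerSumSeries P) := by
  have := laurentDeriv_polyExpansion_prod P.roots
  rwa [prod_roots_eq hP] at this

/-- The link between the equation and the roots: the expansion of `w` has no polynomial part, and
its coefficients are differences of power sums. -/
theorem expansion_logDerivQuot {P Q : ℂ[X]} (hP : P.Monic) (hQ : Q.Monic) :
    expansion (logDerivQuot P Q) = toLaurent (powerSumSeries P - powerSumSeries Q) := by
  have hne : ∀ {R : ℂ[X]}, R.Monic → polyExpansion R ≠ 0 := fun hR h =>
    hR.ne_zero (polyExpansion_injective (by rw [h, map_zero]))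
  have hP0 := hne hP
  have hQ0 := hne hQ
  rw [logDerivQuot, map_div₀, expansion_ratDeriv, map_div₀, expansion_algebraMap,
    expansion_algebraMap, Derivation.leibniz_div, laurentDeriv_polyExpansion hP,
    laurentDeriv_polyExpansion hQ, map_sub]
  simp only [smul_eq_mul]
  field_simp

theorem IsYablonskiiVorobev.monic {N n : ℕ} {Q : ℂ[X]} (h : IsYablonskiiVorobev N n Q) :
    Q.Monic := by
  cases h with
  | zero => exact monic_one
  | succ _ hQ _ => exact hQ

/-- The recursion for the power sums along the sequence of Yablonskii–Vorob'ev polynomials. -/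
theorem rootPowerSum_sub {N : ℕ} {P Q : ℂ[X]} (hP : P.Monic) (hQ : Q.Monic) {α : ℂ}
    (hw : painleveTwo N (logDerivQuot P Q) α = 0) (l : ℕ) :
    rootPowerSum P ((2 * N + 1) * l) - rootPowerSum Q ((2 * N + 1) * l)
      = (expansionCoeff N l).eval α := by
  have h := expansion_painleveTwo N (logDerivQuot P Q) α
  set w := powerSumSeries P - powerSumSeries Q with hwdef
  rw [hw, map_zero, expansion_logDerivQuot hP hQ, ← hwdef,
    ← map_hierarchyOp N toLaurent (invDeriv 1) laurentDeriv toLaurent_invDeriv] at h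
  clear_value w
  -- The equation multiplied by `X = 1/z` involves power series only, so it descends along the
  -- injection into Laurent series.
  have hfix : w = PowerSeries.X * (hierarchyOp N (invDeriv 1) w - PowerSeries.C α) := by
    refine toLaurent_injective ?_
    have hC : toLaurent (PowerSeries.C α) = algebraMap ℂ (LaurentSeries ℂ) α := toLaurent.commutes α
    rw [map_mul, map_sub, hC]
    linear_combination toLaurent PowerSeries.X * h
      - toLaurent w * single_neg_one_mul_toLaurent_X
  rw [eval_expansionCoeff, ← coeff_eq_coeff_approxSol N α 1 w hfix (Nat.lt_succ_self _), hwdef,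
    map_sub, powerSumSeries, powerSumSeries, PowerSeries.coeff_succ_X_mul,
    PowerSeries.coeff_succ_X_mul, PowerSeries.coeff_mk, PowerSeries.coeff_mk]

end LaurentExpansion

/-! ### Power sums of the roots of a polynomial -/

theorem rootPowerSum_zero {P : ℂ[X]} : rootPowerSum P 0 = P.natDegree := by
  rw [rootPowerSum, ← splits_iff_card_roots.1 (IsAlgClosed.splits P)]
  simp

/-- Newton's identities as a differential equation for the reversed polynomial. -/
theorem X_mul_derivative_reverse_prod (s : Multiset ℂ) :
    (PowerSeries.X : PowerSeries ℂ) * PowerSeries.derivative ℂ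
        ((s.map fun a => 1 - PowerSeries.C a * PowerSeries.X).prod)
      = -(s.map fun a => 1 - PowerSeries.C a * PowerSeries.X).prod
        * (PowerSeries.X * PowerSeries.mk fun m => (s.map fun a => a ^ (m + 1)).sum) := by
  induction s using Multiset.induction_on with
  | empty =>
    have h0 : (PowerSeries.mk fun _ => (0 : ℂ)) = 0 := by ext; simp
    simp [h0]
  | cons a s ih =>
    have hsplit : (PowerSeries.mk fun m => ((a ::ₘ s).map fun a => a ^ (m + 1)).sum)
        = PowerSeries.mk (fun m => a ^ (m + 1))
          + PowerSeries.mk fun m => (s.map fun a => a ^ (m + 1)).sum := by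
      ext m
      simp
    have hgeom : (1 - PowerSeries.C a * PowerSeries.X) * PowerSeries.mk (fun m => a ^ (m + 1))
        = PowerSeries.C a := by
      rw [sub_mul, one_mul, mul_assoc]
      ext n
      rw [map_sub, PowerSeries.coeff_C_mul]
      cases n with
      | zero => simp
      | succ n =>
        rw [PowerSeries.coeff_succ_X_mul]
        simp [pow_succ']
    have h2 : PowerSeries.derivative ℂ (1 - PowerSeries.C a * PowerSeries.X)
        = -PowerSeries.C a := by
      rw [map_sub, PowerSeries.derivative_one, Derivation.leibniz, PowerSeries.derivative_C,
        PowerSeries.derivative_X]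
      simp
    rw [hsplit, Multiset.map_cons, Multiset.prod_cons, Derivation.leibniz, h2]
    simp only [smul_eq_mul]
    linear_combination (1 - PowerSeries.C a * PowerSeries.X) * ih
      + (s.map fun a => 1 - PowerSeries.C a * PowerSeries.X).prod * PowerSeries.X * hgeom

/-- Reversal is multiplicative over a domain and sends `X - a` to `1 - aX`. -/
theorem coe_reverse_eq_prod {P : ℂ[X]} (hP : P.Monic) :
    (P.reverse : PowerSeries ℂ)
      = (P.roots.map fun a => 1 - PowerSeries.C a * PowerSeries.X).prod := by
  have h : ∀ s : Multiset ℂ, ((s.map fun a => X - C a).prod.reverse : PowerSeries ℂ)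
      = (s.map fun a => 1 - PowerSeries.C a * PowerSeries.X).prod := fun s => by
    induction s using Multiset.induction_on with
    | empty =>
      have : (1 : ℂ[X]).reverse = 1 := by rw [← C_1, reverse_C]
      simp [this]
    | cons a s ih =>
      have hr : (X - C a : ℂ[X]).reverse = 1 - C a * X := by
        ext n
        rw [coeff_reverse, natDegree_X_sub_C]
        rcases n with _ | _ | n
        · rw [revAt_le (by omega)]; simp
        · rw [revAt_le (by omega)]; simp [coeff_one]
        · rw [revAt_eq_self_of_lt (by omega)]
          simp [coeff_X, coeff_one]
      rw [Multiset.map_cons, Multiset.prod_cons, reverse_mul_of_domain, coe_mul, ih,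
        Multiset.map_cons, Multiset.prod_cons, hr]
      simp
  rw [← h, prod_roots_eq hP]

/-- Newton's identities up to the degree. -/
theorem newton_identity {P : ℂ[X]} (hP : P.Monic) {k : ℕ} (hk : k ≤ P.natDegree) :
    (k : ℂ) * P.coeff (P.natDegree - k)
      + ∑ j ∈ Finset.Icc 1 k, rootPowerSum P j * P.coeff (P.natDegree - (k - j)) = 0 := by
  have hrev : ∀ i ≤ P.natDegree, PowerSeries.coeff i (P.reverse : PowerSeries ℂ)
      = P.coeff (P.natDegree - i) := fun i hi => by
    rw [coeff_coe, coeff_reverse, revAt_le hi]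
  have h := X_mul_derivative_reverse_prod P.roots
  rw [← coe_reverse_eq_prod hP] at h
  cases k with
  | zero => simp
  | succ k =>
    have := congrArg (PowerSeries.coeff (k + 1)) h
    rw [PowerSeries.coeff_succ_X_mul, PowerSeries.coeff_derivative, hrev _ hk, mul_left_comm,
      PowerSeries.coeff_succ_X_mul, neg_mul, map_neg, mul_comm (P.reverse : PowerSeries ℂ),
      PowerSeries.coeff_mul, Finset.Nat.sum_antidiagonal_eq_sum_range_succ_mk] at this
    have hs : ∑ j ∈ Finset.Icc 1 (k + 1),
          rootPowerSum P j * P.coeff (P.natDegree - (k + 1 - j))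
        = ∑ j ∈ Finset.range (k + 1),
          rootPowerSum P (j + 1) * P.coeff (P.natDegree - (k - j)) := by
      have := Finset.sum_Ico_add'
        (fun j => rootPowerSum P j * P.coeff (P.natDegree - (k + 1 - j))) 0 (k + 1) 1
      simp only [Nat.add_sub_add_right] at this
      rw [Finset.range_eq_Ico, this]
      rfl
    rw [hs]
    push_cast
    rw [mul_comm, this, neg_add_eq_zero]
    refine Finset.sum_congr rfl fun j hj => ?_
    rw [Finset.mem_range] at hj
    simp only [PowerSeries.coeff_mk]
    rw [hrev _ (by omega)]
    rfl

/-- Newton's identities beyond the degree. -/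
theorem newton_identity_of_lt {P : ℂ[X]} (hP : P.Monic) {m : ℕ} (hm : P.natDegree < m) :
    rootPowerSum P m
      + ∑ j ∈ Finset.Icc 1 P.natDegree, P.coeff (P.natDegree - j) * rootPowerSum P (m - j)
      = 0 := by
  -- This is `P(a) = 0` multiplied by `a^(m - deg P)`; the identity follows by summing over the
  -- roots.
  have hroot : ∀ a ∈ P.roots, a ^ m
      + ∑ j ∈ Finset.Icc 1 P.natDegree, P.coeff (P.natDegree - j) * a ^ (m - j) = 0 := by
    intro a ha
    have h0 : P.eval a = 0 := (mem_roots'.1 ha).2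
    rw [eval_eq_sum_range, ← Finset.sum_range_reflect, Finset.sum_range_succ'] at h0
    simp only [Nat.add_sub_cancel, Nat.sub_zero, hP.coeff_natDegree, one_mul] at h0
    have hs : ∑ j ∈ Finset.Icc 1 P.natDegree, P.coeff (P.natDegree - j) * a ^ (m - j)
        = ∑ j ∈ Finset.range P.natDegree,
          P.coeff (P.natDegree - (j + 1)) * a ^ (m - (j + 1)) := by
      rw [Finset.range_eq_Ico, Finset.sum_Ico_add'
        (fun j => P.coeff (P.natDegree - j) * a ^ (m - j)) 0 P.natDegree 1]
      rfl
    rw [hs]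
    have h1 := congrArg (a ^ (m - P.natDegree) * ·) h0
    simp only [mul_add, mul_zero, ← pow_add, Finset.mul_sum] at h1
    rw [Nat.sub_add_cancel hm.le, add_comm] at h1
    rw [← h1]
    congr 1
    refine Finset.sum_congr rfl fun j hj => ?_
    rw [Finset.mem_range] at hj
    rw [mul_left_comm, ← pow_add]
    congr 2
    omega
  have h := congrArg Multiset.sum (Multiset.map_congr rfl hroot)
  simp only [Multiset.sum_map_add, Multiset.map_const', Multiset.sum_replicate, smul_zero] at h
  rw [← h, rootPowerSum]
  congr 1
  simp only [rootPowerSum, ← Multiset.sum_map_mul_left, Finset.sum]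
  exact Multiset.sum_map_sum_map _ _

/-! ### Power sums as universal polynomials in the first `p` -/

/-- A function on monic polynomials of degree `p` that is a polynomial over `ℚ` in the first `p`
power sums of the roots. -/
def IsPolynomialInPowerSums (p : ℕ) (φ : ℂ[X] → ℂ) : Prop :=
  ∃ F : MvPolynomial (Fin p) ℚ, ∀ P : ℂ[X], P.Monic → P.natDegree = p →
    φ P = MvPolynomial.aeval (fun i : Fin p => rootPowerSum P (i + 1)) F

namespace IsPolynomialInPowerSums

variable {p : ℕ} {φ ψ : ℂ[X] → ℂ}

theorem mul (hφ : IsPolynomialInPowerSums p φ) (hψ : IsPolynomialInPowerSums p ψ) :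
    IsPolynomialInPowerSums p fun P => φ P * ψ P := by
  obtain ⟨F, hF⟩ := hφ
  obtain ⟨G, hG⟩ := hψ
  exact ⟨F * G, fun P h1 h2 => by simp only [hF P h1 h2, hG P h1 h2, map_mul]⟩

theorem const_mul (c : ℚ) (hφ : IsPolynomialInPowerSums p φ) :
    IsPolynomialInPowerSums p fun P => (c : ℂ) * φ P := by
  obtain ⟨F, hF⟩ := hφ
  exact ⟨MvPolynomial.C c * F, fun P h1 h2 => by
    simp only [hF P h1 h2, map_mul, MvPolynomial.aeval_C, eq_ratCast]⟩

theorem sum {ι : Type*} (s : Finset ι) {φ : ι → ℂ[X] → ℂ}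
    (h : ∀ i ∈ s, IsPolynomialInPowerSums p (φ i)) :
    IsPolynomialInPowerSums p fun P => ∑ i ∈ s, φ i P := by
  choose! F hF using h
  refine ⟨∑ i ∈ s, F i, fun P h1 h2 => ?_⟩
  rw [map_sum]
  exact Finset.sum_congr rfl fun i hi => hF i hi P h1 h2

theorem congr (hφ : IsPolynomialInPowerSums p φ)
    (h : ∀ P : ℂ[X], P.Monic → P.natDegree = p → ψ P = φ P) : IsPolynomialInPowerSums p ψ := by
  obtain ⟨F, hF⟩ := hφ
  exact ⟨F, fun P h1 h2 => by rw [h P h1 h2, hF P h1 h2]⟩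

theorem rootPowerSum_of_le {j : ℕ} (hj : 1 ≤ j) (hjp : j ≤ p) :
    IsPolynomialInPowerSums p fun P => rootPowerSum P j :=
  ⟨MvPolynomial.X ⟨j - 1, by omega⟩, fun P _ _ => by
    rw [MvPolynomial.aeval_X]
    simp only [Nat.sub_add_cancel hj]⟩

/-- Newton's identity is solved for the `k`-th coefficient; dividing by `k` is what requires
rational coefficients. -/
theorem coeff {k : ℕ} (hk : k ≤ p) : IsPolynomialInPowerSums p fun P => P.coeff (p - k) := by
  induction k using Nat.strong_induction_on with
  | _ k ih =>
    cases k with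
    | zero =>
      exact ⟨1, fun P h1 h2 => by
        simp only [map_one, Nat.sub_zero, ← h2, h1.coeff_natDegree]⟩
    | succ k =>
      have hs : IsPolynomialInPowerSums p fun P =>
          ∑ j ∈ Finset.Icc 1 (k + 1), rootPowerSum P j * P.coeff (p - (k + 1 - j)) :=
        sum _ fun j hj => by
          rw [Finset.mem_Icc] at hj
          exact (rootPowerSum_of_le hj.1 (by omega)).mul (ih (k + 1 - j) (by omega) (by omega))
      refine (const_mul (-((k : ℚ) + 1)⁻¹) hs).congr fun P h1 h2 => ?_
      have h := newton_identity h1 (h2 ▸ hk)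
      rw [h2] at h
      have hk0 : (k : ℂ) + 1 ≠ 0 := by exact_mod_cast Nat.succ_ne_zero k
      push_cast at h ⊢
      field_simp
      linear_combination h

/-- All power sums are polynomials in the first `p` ones. -/
theorem rootPowerSum {m : ℕ} (hm : 1 ≤ m) :
    IsPolynomialInPowerSums p fun P => rootPowerSum P m := by
  induction m using Nat.strong_induction_on with
  | _ m ih =>
    rcases le_or_gt m p with hmp | hmp
    · exact rootPowerSum_of_le hm hmp
    · have hs : IsPolynomialInPowerSums p fun P =>
          ∑ j ∈ Finset.Icc 1 p, P.coeff (p - j) * PainleveTwo.rootPowerSum P (m - j) :=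
        sum _ fun j hj => by
          rw [Finset.mem_Icc] at hj
          -- As `j ≤ p < m`, the index `m - j` stays positive, so the zeroth power sum never enters.
          exact (coeff hj.2).mul (ih (m - j) (by omega) (by omega))
      refine (const_mul (-1) hs).congr fun P h1 h2 => ?_
      have h := newton_identity_of_lt h1 (h2 ▸ hmp)
      rw [h2] at h
      push_cast
      linear_combination h

end IsPolynomialInPowerSums

/-! ### Summation of polynomials -/

/-- A polynomial of degree `d` is the backward difference of a polynomial of degree `d + 1`. -/
theorem exists_backward_antidifference (d : ℕ) (p : ℂ[X]) (hp : p.natDegree ≤ d) :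
    ∃ T : ℂ[X], T.natDegree ≤ d + 1 ∧ T.coeff (d + 1) = p.coeff d / (d + 1) ∧
      ∀ x : ℂ, T.eval (x + 1) - T.eval x = p.eval (x + 1) := by
  induction d using Nat.strong_induction_on generalizing p with
  | _ d ih =>
    set c : ℂ := p.coeff d / (d + 1) with hc
    have hd0 : (d : ℂ) + 1 ≠ 0 := by exact_mod_cast Nat.succ_ne_zero d
    -- The backward difference of `X^(d+1)` has `X^d`-coefficient `d + 1`, so this choice of `c`
    -- removes the term of degree `d`, and induction applies to `r`.
    set r : ℂ[X] := p - C c * (X ^ (d + 1) - (X - 1) ^ (d + 1)) with hr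
    have hcoeff : ∀ k, ((X - 1 : ℂ[X]) ^ (d + 1)).coeff k
        = (-1) ^ (d + 1 - k) * ((d + 1).choose k : ℂ) := fun k => by
      have := coeff_X_add_C_pow (-1 : ℂ) (d + 1) k
      rwa [C_neg, C_1, ← sub_eq_add_neg] at this
    have hr0 : ∀ k, d ≤ k → r.coeff k = 0 := fun k hk => by
      rw [hr, coeff_sub, coeff_C_mul, coeff_sub, coeff_X_pow, hcoeff]
      rcases hk.eq_or_lt with rfl | hk
      · rw [if_neg (by omega), Nat.add_sub_cancel_left, Nat.choose_succ_self_right, hc]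
        push_cast
        field_simp
        ring
      · rw [coeff_eq_zero_of_natDegree_lt (lt_of_le_of_lt hp hk)]
        rcases (show d + 1 ≤ k from hk).eq_or_lt with rfl | hk
        · simp
        · rw [if_neg (by omega), Nat.choose_eq_zero_of_lt hk]
          simp
    have hev : ∀ x : ℂ, r.eval (x + 1)
        = p.eval (x + 1) - c * ((x + 1) ^ (d + 1) - x ^ (d + 1)) := fun x => by
      simp [hr]
    have hT0 : (C c * X ^ (d + 1)).natDegree ≤ d + 1 := natDegree_C_mul_X_pow_le _ _
    cases d with
    | zero =>
      have hz : r = 0 := by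
        ext k
        rw [hr0 k (Nat.zero_le k), coeff_zero]
      refine ⟨C c * X ^ (0 + 1), hT0, by simp, fun x => ?_⟩
      have := hev x
      rw [hz, eval_zero] at this
      simp only [eval_mul, eval_C, eval_pow, eval_X]
      linear_combination this
    | succ d =>
      have hrd : r.natDegree ≤ d := natDegree_le_iff_coeff_eq_zero.2 fun k hk => hr0 k hk
      obtain ⟨T, hT1, -, hT3⟩ := ih d (Nat.lt_succ_self d) r hrd
      refine ⟨T + C c * X ^ (d + 1 + 1), ?_, ?_, fun x => ?_⟩
      · exact natDegree_add_le_of_degree_le (hT1.trans (by omega)) hT0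
      · rw [coeff_add, coeff_eq_zero_of_natDegree_lt (by omega : T.natDegree < d + 1 + 1), zero_add]
        simp
      · have h1 := hev x
        have h2 := hT3 x
        simp only [eval_add, eval_mul, eval_C, eval_pow, eval_X]
        linear_combination h2 + h1

/-! ### Power sums and degrees of the Yablonskii–Vorob'ev polynomials -/

/-- The power sums `s_{n, (2N+1) l}` are given by a polynomial in `n` of degree `2 (N l + 1)`. -/
theorem exists_powerSum_polynomial (N l : ℕ) :
    ∃ S : ℂ[X], S.natDegree = 2 * (N * l + 1) ∧
      ∀ (n : ℕ) (Q : ℂ[X]), IsYablonskiiVorobev N n Q →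
        rootPowerSum Q ((2 * N + 1) * l) = S.eval (n : ℂ) := by
  have hdeg := natDegree_expansionCoeff N l
  obtain ⟨T, hT1, hT2, hT3⟩ := exists_backward_antidifference (2 * N * l + 1)
    (-expansionCoeff N l) (by rw [natDegree_neg, hdeg])
  have hlead : T.coeff (2 * N * l + 1 + 1) ≠ 0 := by
    rw [hT2]
    refine div_ne_zero ?_ (by exact_mod_cast Nat.succ_ne_zero (2 * N * l + 1))
    rw [coeff_neg, neg_ne_zero, ← hdeg, coeff_natDegree, leadingCoeff_ne_zero]
    intro h
    rw [h] at hdeg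
    simp at hdeg
  have hTd : T.natDegree = 2 * (N * l + 1) := by
    rw [natDegree_eq_of_le_of_coeff_ne_zero hT1 hlead]
    ring
  have hS : ∀ x : ℂ, (T - C (T.eval 0)).eval (x + 1) - (T - C (T.eval 0)).eval x
      = -(expansionCoeff N l).eval (x + 1) := fun x => by
    have := hT3 x
    rw [eval_neg] at this
    simp only [eval_sub, eval_C]
    linear_combination this
  -- The constant is fixed by `Q_0 = 1`, which has no roots, so the sum must vanish at `n = 0`.
  refine ⟨T - C (T.eval 0), by rw [natDegree_sub_C, hTd], fun n Q hQ => ?_⟩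
  induction hQ with
  | zero => simp [rootPowerSum]
  | @succ n P Q hP hQ hw ih =>
    have h1 := rootPowerSum_sub hP.monic hQ hw l
    have h2 := hS n
    push_cast at h1 ⊢
    linear_combination ih - h1 - h2

/-- For `w = O(1/z)` the hierarchy operator has no constant term, so `w = -α/z + …`. -/
theorem eval_expansionCoeff_zero (N : ℕ) (α : ℂ) : (expansionCoeff N 0).eval α = -α := by
  have h1 : PowerSeries.constantCoeff (approxSol N α 1 1) = 0 := by
    rw [approxSol_succ, map_mul, PowerSeries.constantCoeff_X, zero_mul]
  have h2 : PowerSeries.constantCoeff (hierarchyOp N (invDeriv 1) (approxSol N α 1 1)) = 0 := by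
    simp [hierarchyOp, invDeriv_apply, h1]
  rw [eval_expansionCoeff]
  change PowerSeries.coeff (0 + 1) (approxSol N α 1 (1 + 1)) = -α
  rw [approxSol_succ, PowerSeries.coeff_succ_X_mul, PowerSeries.coeff_zero_eq_constantCoeff_apply,
    map_sub, h2, PowerSeries.constantCoeff_C, zero_sub]

/-- The zeroth power sum is the degree, so the recursion at `l = 0` says that the degree grows by
`n` from `Q_{n-1}` to `Q_n`. -/
theorem IsYablonskiiVorobev.natDegree_eq {N n : ℕ} {Q : ℂ[X]} (h : IsYablonskiiVorobev N n Q) :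
    Q.natDegree = n * (n + 1) / 2 := by
  have key : (Q.natDegree : ℂ) * 2 = n * (n + 1) := by
    induction h with
    | zero => simp
    | @succ n P Q hP hQ hw ih =>
      have h1 := rootPowerSum_sub hP.monic hQ hw 0
      rw [mul_zero, rootPowerSum_zero, rootPowerSum_zero, eval_expansionCoeff_zero] at h1
      push_cast at h1 ⊢
      linear_combination ih - 2 * h1
  have key' : Q.natDegree * 2 = n * (n + 1) := by exact_mod_cast key
  omega

end PainleveTwo

theorem theorem4 (N : ℕ) (hN : 1 ≤ N) :
    (∀ n : ℕ, 2 ≤ n →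
      (∀ Q : ℂ[X], PainleveTwo.IsYablonskiiVorobev N n Q →
        Q.natDegree = n * (n + 1) / 2 ∧
        (∀ k : ℕ, 1 ≤ k → k ≤ n * (n + 1) / 2 →
          (k : ℂ) * Q.coeff (n * (n + 1) / 2 - k)
            + ∑ j ∈ Finset.Icc 1 k,
                PainleveTwo.rootPowerSum Q j * Q.coeff (n * (n + 1) / 2 - (k - j)) = 0) ∧
        (∀ m : ℕ, n * (n + 1) / 2 < m →
          PainleveTwo.rootPowerSum Q m
            + ∑ j ∈ Finset.Icc 1 (n * (n + 1) / 2),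
                Q.coeff (n * (n + 1) / 2 - j) * PainleveTwo.rootPowerSum Q (m - j) = 0)) ∧
      (∀ m : ℕ, n * (n + 1) / 2 < m →
        ∃ F : MvPolynomial (Fin (n * (n + 1) / 2)) ℚ,
          ∀ P : ℂ[X], P.Monic → P.natDegree = n * (n + 1) / 2 →
            PainleveTwo.rootPowerSum P m
              = MvPolynomial.aeval
                  (fun i : Fin (n * (n + 1) / 2) => PainleveTwo.rootPowerSum P (i + 1)) F)) ∧
    (∀ l : ℕ, 1 ≤ l →
      ∃ S : ℂ[X], S.natDegree = 2 * (N * l + 1) ∧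
        ∀ (n : ℕ) (Q : ℂ[X]), PainleveTwo.IsYablonskiiVorobev N n Q →
          PainleveTwo.rootPowerSum Q ((2 * N + 1) * l) = S.eval (n : ℂ)) := by
  refine ⟨fun n _ => ⟨fun Q hQ => ?_, fun m hm => ?_⟩, fun l _ => ?_⟩
  · have hd := hQ.natDegree_eq
    rw [← hd]
    exact ⟨rfl, fun k _ hk => PainleveTwo.newton_identity hQ.monic hk,
      fun m hm => PainleveTwo.newton_identity_of_lt hQ.monic hm⟩
  · exact PainleveTwo.IsPolynomialInPowerSums.rootPowerSum (by omega)
  · exact PainleveTwo.exists_powerSum_polynomial N l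

end
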